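/- Let $G=(V,E)$ be a finite directed acyclic graph (parallel edges allowed) with unit-capacity edges, with two source nodes $S_1,S_2$ and $n$ terminal nodes $T_1,\dots,T_n$ such that $\text{max-flow}(S_i-T_j)\ge 1$ for $i=1,2$ and $j=1,\dots,n$. The source $S_i$ emits a unit-rate source $X_i$, that is, one symbol of the finite field $GF(2^m)$ per unit of time, in which every edge carries one symbol of $GF(2^m)$; $X_1$ and $X_2$ are independent, so that every pair of symbols may occur. In a linear network code over $GF(2^m)$ the signal $Y_e$ on an edge $e$ is a fixed $GF(2^m)$-linear combination of the signals on the edges entering the tail of $e$ and of the source symbols observed at the tail of $e$; if $Y_e=\beta_{e,1}X_1+\beta_{e,2}X_2$, then $[\beta_{e,1}\ \beta_{e,2}]$ is the global coding vector of $e$. Then for all sufficiently large $m$ there is a linear network code over $GF(2^m)$, that is, an assignment of global coding vectors to all edges which is realized by such linear combinations, under which every terminal $T_j$ recovers $X_1+X_2$: for all values of $X_1,X_2\in GF(2^m)$, a fixed linear combination of the signals on the edges entering $T_j$ (and of the source symbol observed at $T_j$, if any) equals $X_1+X_2$. -/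

import Mathlib

/-- A directed multigraph with node set `V` and edge set `E`, where every edge has unit capacity
(an edge of larger integer capacity is several parallel edges). -/
structure Network (V E : Type*) where
  /-- the node that the edge leaves -/
  tail : E → V
  /-- the node that the edge enters -/
  head : E → V

namespace Network

/-- Some edge leads from `u` to `v`. -/
def Adj {V E : Type*} (G : Network V E) (u v : V) : Prop :=
  ∃ e, G.tail e = u ∧ G.head e = v

/-- There is no directed path of positive length from a node to itself. -/
def Acyclic {V E : Type*} (G : Network V E) : Prop :=
  ∀ v, ¬ Relation.TransGen G.Adj v v

/-- The edges entering `v`. -/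
def inEdges {V E : Type*} [Fintype E] [DecidableEq V] (G : Network V E) (v : V) : Finset E :=
  Finset.univ.filter fun e => G.head e = v

/-- The edges leaving `v`. -/
def outEdges {V E : Type*} [Fintype E] [DecidableEq V] (G : Network V E) (v : V) : Finset E :=
  Finset.univ.filter fun e => G.tail e = v

/-- `φ` is a flow from `s` to `t` for unit edge capacities. -/
def IsFlow {V E : Type*} [Fintype E] [DecidableEq V] (G : Network V E) (s t : V)
    (φ : E → ℝ) : Prop :=
  (∀ e, 0 ≤ φ e ∧ φ e ≤ 1) ∧
    ∀ v, v ≠ s → v ≠ t → ∑ e ∈ G.inEdges v, φ e = ∑ e ∈ G.outEdges v, φ e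

/-- The net amount that leaves `s` under `φ`. -/
def flowValue {V E : Type*} [Fintype E] [DecidableEq V] (G : Network V E) (s : V)
    (φ : E → ℝ) : ℝ :=
  ∑ e ∈ G.outEdges s, φ e - ∑ e ∈ G.inEdges s, φ e

/-- The maximal value of a flow from `s` to `t`. The supremum is over a set that contains `0` and
is bounded above by the number of edges. -/
noncomputable def maxFlow {V E : Type*} [Fintype E] [DecidableEq V] (G : Network V E)
    (s t : V) : ℝ :=
  sSup {r : ℝ | ∃ φ : E → ℝ, G.IsFlow s t φ ∧ G.flowValue s φ = r}

end Network

/-- The coefficients of a (scalar) linear network code over `K` with sources indexed by `ι`. -/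
structure LinearCode (ι E K : Type*) where
  /-- `a i e` is the weight of the source symbol `i` on the edge `e`;
  it is used only if source `i` is observed at the tail of `e` -/
  a : ι → E → K
  /-- `f e' e` is the weight of the signal of `e'` on the edge `e`;
  it is used only if the head of `e'` is the tail of `e` -/
  f : E → E → K

namespace LinearCode

/-- `Y` is the family of signals on the edges when source `i`, located at the node `S i`, emits
the symbol `x i`: the signal on an edge is the prescribed linear combination of the signals on the
edges entering its tail and of the source symbols observed at its tail. -/
def IsSignal {V E ι K : Type*} [Fintype E] [DecidableEq V] [Fintype ι] [Field K]
    (c : LinearCode ι E K) (G : Network V E) (S : ι → V) (x : ι → K) (Y : E → K) : Prop :=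
  ∀ e, Y e = ∑ e' ∈ G.inEdges (G.tail e), c.f e' e * Y e' +
    ∑ i ∈ Finset.univ.filter (fun i => S i = G.tail e), c.a i e * x i

/-- `β e` is the global coding vector of each edge `e`: for every choice `x` of the source symbols,
there is exactly one family of signals, and it is given by `Y e = ∑ i, β e i * x i`. -/
def IsGlobalCoding {V E ι K : Type*} [Fintype E] [DecidableEq V] [Fintype ι] [Field K]
    (c : LinearCode ι E K) (G : Network V E) (S : ι → V) (β : E → ι → K) : Prop :=
  ∀ (x : ι → K) (Y : E → K), c.IsSignal G S x Y ↔ ∀ e, Y e = ∑ i, β e i * x i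

/-- The node `t` recovers the sum of all source symbols, by a fixed linear combination of the
signals on the edges that enter `t` (and of the source symbols observed at `t`, if any), whatever
the source symbols are. -/
def RecoversSum {V E ι K : Type*} [Fintype E] [DecidableEq V] [Fintype ι] [Field K]
    (c : LinearCode ι E K) (G : Network V E) (S : ι → V) (t : V) : Prop :=
  ∃ (g : E → K) (h : ι → K), ∀ (x : ι → K) (Y : E → K), c.IsSignal G S x Y →
    ∑ e ∈ G.inEdges t, g e * Y e + ∑ i ∈ Finset.univ.filter (fun i => S i = t), h i * x i
      = ∑ i, x i

end LinearCode

namespace Network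

variable {V E : Type*} (G : Network V E)

/-! Let every edge carry the sum of the source symbols that reach its tail. A node can form its own
such sum: if only one source reaches it, it observes that symbol or has a predecessor reached by
that source alone; if both do, either some incoming edge carries `X₁ + X₂`, or both symbols are
available separately. All nonzero coefficient vectors are 0-1, so any field works. Flow is needed
only to give paths to the terminals. -/

/-- A positive maximal flow from `s` to `t` yields a directed path from `s` to `t`. -/
theorem reachable_of_maxFlow_pos [Fintype V] [DecidableEq V] [Fintype E] {s t : V}
    (h : 0 < G.maxFlow s t) : Relation.ReflTransGen G.Adj s t := by
  classical
  by_contra hst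
  refine h.not_ge (Real.sSup_le ?_ le_rfl)
  rintro r ⟨φ, ⟨hφ, hcons⟩, rfl⟩
  -- Cut argument: `R` omits `t` and no edge leaves it, so its net outflow, which is the flow value,
  -- is at most 0.
  set R : Finset V := Finset.univ.filter (Relation.ReflTransGen G.Adj s) with hR
  have memR : ∀ v, v ∈ R ↔ Relation.ReflTransGen G.Adj s v := fun v => by simp [hR]
  have hval : G.flowValue s φ
      = ∑ v ∈ R, (∑ e ∈ G.outEdges v, φ e - ∑ e ∈ G.inEdges v, φ e) := by
    rw [Finset.sum_eq_single_of_mem s ((memR s).2 .refl)]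
    · rfl
    · intro v hv hvs
      have hvt : v ≠ t := by
        rintro rfl
        exact hst ((memR v).1 hv)
      rw [hcons v hvs hvt, sub_self]
  have hout : ∑ v ∈ R, ∑ e ∈ G.outEdges v, φ e = ∑ e with G.tail e ∈ R, φ e := by
    simp only [outEdges, Finset.sum_filter]
    rw [Finset.sum_comm]
    simp
  have hin : ∑ v ∈ R, ∑ e ∈ G.inEdges v, φ e = ∑ e with G.head e ∈ R, φ e := by
    simp only [inEdges, Finset.sum_filter]
    rw [Finset.sum_comm]
    simp
  rw [hval, Finset.sum_sub_distrib, hout, hin, sub_nonpos]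
  refine Finset.sum_le_sum_of_subset_of_nonneg ?_ fun e _ _ => (hφ e).1
  intro e he
  simp only [Finset.mem_filter, Finset.mem_univ, true_and, memR] at he ⊢
  exact he.tail ⟨e, rfl, rfl⟩

/-- The edges of a finite acyclic network can be processed in topological order. -/
theorem Acyclic.wellFounded [Finite V] {G : Network V E} (hG : G.Acyclic) :
    WellFounded fun e' e : E => G.head e' = G.tail e := by
  have : Std.Irrefl (Relation.TransGen G.Adj) := ⟨hG⟩
  have hwf : WellFounded (Relation.TransGen G.Adj) :=
    Finite.wellFounded_of_trans_of_irrefl _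
  refine Subrelation.wf ?_ (InvImage.wf G.tail hwf)
  intro e' e h
  exact .single ⟨e', rfl, h⟩

open Classical in
/-- The vector that records which of the sources reach `v`. -/
noncomputable def reachVector {ι : Type*} (K : Type*) [Zero K] [One K] (S : ι → V) (v : V) :
    ι → K :=
  fun i => if Relation.ReflTransGen G.Adj (S i) v then 1 else 0

/-- When the edge `e` carries the coding vector `β e`, the vectors that can be formed at the
node `v` from the edges entering `v` and the source symbols observed at `v`. -/
def localSpan {ι K : Type*} [Fintype E] [DecidableEq V] [Fintype ι] [DecidableEq ι] [Field K]
    (S : ι → V) (β : E → ι → K) (v : V) : Submodule K (ι → K) where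
  carrier := {w | ∃ (g : E → K) (h : ι → K),
    w = ∑ e ∈ G.inEdges v, g e • β e +
      ∑ i ∈ Finset.univ.filter (fun i => S i = v), h i • Pi.single i 1}
  zero_mem' := ⟨0, 0, by simp⟩
  add_mem' := by
    rintro _ _ ⟨g, h, rfl⟩ ⟨g', h', rfl⟩
    refine ⟨g + g', h + h', ?_⟩
    simp only [Pi.add_apply, add_smul, Finset.sum_add_distrib]
    abel
  smul_mem' := by
    rintro a _ ⟨g, h, rfl⟩
    refine ⟨a • g, a • h, ?_⟩
    simp only [smul_add, Finset.smul_sum, Pi.smul_apply, smul_assoc]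

section

variable [Fintype E] [DecidableEq V] {ι K : Type*} [Fintype ι] [DecidableEq ι] [Field K]
  (S : ι → V) (β : E → ι → K)

theorem edge_mem_localSpan (e : E) : β e ∈ G.localSpan S β (G.head e) := by
  classical
  refine ⟨Pi.single e 1, 0, ?_⟩
  rw [Finset.sum_eq_single_of_mem e (by simp [inEdges])]
  · simp
  · intro e' _ he'
    simp [he']

theorem source_mem_localSpan (i : ι) :
    (Pi.single i 1 : ι → K) ∈ G.localSpan S β (S i) := by
  refine ⟨0, Pi.single i 1, ?_⟩
  rw [Finset.sum_eq_single_of_mem (s := Finset.univ.filter fun j => S j = S i) i (by simp)]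
  · simp
  · intro j _ hj
    simp [hj]

/-- Pairing with `x` turns membership into decoding by coefficients independent of `x`. -/
theorem exists_coeff_of_mem_localSpan {v : V} {w : ι → K} (hw : w ∈ G.localSpan S β v) :
    ∃ (g : E → K) (h : ι → K), ∀ x : ι → K,
      ∑ e ∈ G.inEdges v, g e * ∑ i, β e i * x i +
        ∑ i ∈ Finset.univ.filter (fun i => S i = v), h i * x i = ∑ i, w i * x i := by
  obtain ⟨g, h, rfl⟩ := hw
  refine ⟨g, h, fun x => ?_⟩
  simp only [Pi.add_apply, Finset.sum_apply, Pi.smul_apply, smul_eq_mul, add_mul,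
    Finset.sum_add_distrib, Finset.sum_mul]
  congr 1
  · rw [Finset.sum_comm]
    simp only [Finset.mul_sum, mul_assoc]
  · rw [Finset.sum_comm]
    refine Finset.sum_congr rfl fun i _ => ?_
    simp [Pi.single_apply]

end

/-- With two sources, if every edge carries the sum of the source symbols that reach its tail,
every node can form the sum of the source symbols that reach it. -/
theorem reachVector_mem_localSpan [Fintype E] [DecidableEq V] {K : Type*} [Field K]
    (S : Fin 2 → V) (v : V) :
    G.reachVector K S v ∈ G.localSpan S (fun e => G.reachVector K S (G.tail e)) v := by
  set W := G.localSpan S (fun e => G.reachVector K S (G.tail e)) v with hW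
  -- The last edge of a path from `S i` supplies the vector of a predecessor `u` that source `i`
  -- reaches.
  have key : ∀ i, Relation.ReflTransGen G.Adj (S i) v →
      (Pi.single i 1 : Fin 2 → K) ∈ W ∨ ∃ u, Relation.ReflTransGen G.Adj (S i) u ∧
        G.Adj u v ∧ G.reachVector K S u ∈ W := by
    intro i hi
    rcases Relation.ReflTransGen.cases_tail hi with h | ⟨u, hu, e, rfl, rfl⟩
    · left
      rw [hW, h]
      exact G.source_mem_localSpan S _ i
    · exact .inr ⟨_, hu, ⟨e, rfl, rfl⟩, G.edge_mem_localSpan S _ e⟩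
  by_cases h0 : Relation.ReflTransGen G.Adj (S 0) v <;>
    by_cases h1 : Relation.ReflTransGen G.Adj (S 1) v
  · have hv : G.reachVector K S v = Pi.single 0 1 + Pi.single 1 1 := by
      funext k; fin_cases k <;> simp [reachVector, h0, h1]
    rw [hv]
    have aux : ∀ u, Relation.ReflTransGen G.Adj (S 0) u → Relation.ReflTransGen G.Adj (S 1) u →
        G.reachVector K S u = Pi.single 0 1 + Pi.single 1 1 := by
      intro u hu hu'
      funext k; fin_cases k <;> simp [reachVector, hu, hu']
    rcases key 0 h0 with a | ⟨u, hu, -, a⟩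
    · rcases key 1 h1 with b | ⟨w, hw, -, b⟩
      · exact W.add_mem a b
      · by_cases hw' : Relation.ReflTransGen G.Adj (S 0) w
        · rwa [aux w hw' hw] at b
        · have : G.reachVector K S w = Pi.single 1 1 := by
            funext k; fin_cases k <;> simp [reachVector, hw, hw']
          exact W.add_mem a (this ▸ b)
    · by_cases hu' : Relation.ReflTransGen G.Adj (S 1) u
      · rwa [aux u hu hu'] at a
      · have hu0 : G.reachVector K S u = Pi.single 0 1 := by
          funext k; fin_cases k <;> simp [reachVector, hu, hu']
        rw [hu0] at a
        rcases key 1 h1 with b | ⟨w, hw, -, b⟩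
        · exact W.add_mem a b
        · by_cases hw' : Relation.ReflTransGen G.Adj (S 0) w
          · rwa [aux w hw' hw] at b
          · have : G.reachVector K S w = Pi.single 1 1 := by
              funext k; fin_cases k <;> simp [reachVector, hw, hw']
            exact W.add_mem a (this ▸ b)
  · have hv : G.reachVector K S v = Pi.single 0 1 := by
      funext k; fin_cases k <;> simp [reachVector, h0, h1]
    rcases key 0 h0 with a | ⟨u, hu, huv, a⟩
    · rwa [hv]
    · have hu' : ¬ Relation.ReflTransGen G.Adj (S 1) u := fun h => h1 (h.tail huv)
      convert a using 1
      funext k; fin_cases k <;> simp [reachVector, h0, h1, hu, hu']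
  · have hv : G.reachVector K S v = Pi.single 1 1 := by
      funext k; fin_cases k <;> simp [reachVector, h0, h1]
    rcases key 1 h1 with a | ⟨u, hu, huv, a⟩
    · rwa [hv]
    · have hu' : ¬ Relation.ReflTransGen G.Adj (S 0) u := fun h => h0 (h.tail huv)
      convert a using 1
      funext k; fin_cases k <;> simp [reachVector, h0, h1, hu, hu']
  · have hv : G.reachVector K S v = 0 := by
      funext k; fin_cases k <;> simp [reachVector, h0, h1]
    rw [hv]
    exact W.zero_mem

end Network

/-- Over any field, two sources can be summed at all nodes that both of them reach. -/
theorem LinearCode.exists_recoversSum_of_reachable {V E K : Type*} [Finite V] [DecidableEq V]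
    [Fintype E] [Field K] (G : Network V E) (hG : G.Acyclic) (S : Fin 2 → V) :
    ∃ (c : LinearCode (Fin 2) E K) (β : E → Fin 2 → K), c.IsGlobalCoding G S β ∧
      ∀ t, (∀ i, Relation.ReflTransGen G.Adj (S i) t) → c.RecoversSum G S t := by
  -- One choice per node serves both as the code on all its outgoing edges and as its decoder.
  choose g h hgh using fun v =>
    G.exists_coeff_of_mem_localSpan S _ (G.reachVector_mem_localSpan (K := K) S v)
  let c : LinearCode (Fin 2) E K :=
    ⟨fun i e => h (G.tail e) i, fun e' e => g (G.tail e) e'⟩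
  have hc : c.IsGlobalCoding G S fun e => G.reachVector K S (G.tail e) := by
    intro x Y
    constructor
    · intro hY e
      -- Acyclicity makes the signals unique; the converse only checks the equations.
      induction e using hG.wellFounded.induction with
      | _ e ih =>
        rw [hY e, ← hgh (G.tail e) x]
        congr 1
        refine Finset.sum_congr rfl fun e' he' => ?_
        rw [ih e' (by simpa [Network.inEdges] using he')]
    · intro hY e
      rw [hY e, ← hgh (G.tail e) x]
      congr 1
      exact Finset.sum_congr rfl fun e' _ => by rw [hY e']
  refine ⟨c, _, hc, fun t ht => ⟨g t, h t, fun x Y hY => ?_⟩⟩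
  have hY' := (hc x Y).1 hY
  have hsum := hgh t x
  simp only [← hY'] at hsum
  rw [hsum]
  simp [Network.reachVector, ht]

theorem theorem1 {V E : Type*} [Fintype V] [DecidableEq V] [Fintype E]
    (G : Network V E) (hG : G.Acyclic) (n : ℕ) (S : Fin 2 → V) (T : Fin n → V)
    (hflow : ∀ (i : Fin 2) (j : Fin n), 1 ≤ G.maxFlow (S i) (T j)) :
    ∃ m₀ : ℕ, 1 ≤ m₀ ∧ ∀ m : ℕ, m₀ ≤ m →
      ∃ (c : LinearCode (Fin 2) E (GaloisField 2 m)) (β : E → Fin 2 → GaloisField 2 m),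
        c.IsGlobalCoding G S β ∧ ∀ j : Fin n, c.RecoversSum G S (T j) := by
  refine ⟨1, le_rfl, fun m _ => ?_⟩
  obtain ⟨c, β, hc, hrec⟩ :=
    LinearCode.exists_recoversSum_of_reachable (K := GaloisField 2 m) G hG S
  exact ⟨c, β, hc, fun j => hrec _ fun i =>
    G.reachable_of_maxFlow_pos (zero_lt_one.trans_le (hflow i j))⟩
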